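/- **Game.** Cops and Cheating Robot is played on a graph $G$ by $m$ cops against a robber, Robert, with perfect information. The cops first choose starting vertices (several cops may share a vertex); then Robert chooses a starting vertex not occupied by a cop. In each round every cop first stays at her vertex or moves to an adjacent vertex, and then Robert stays at his vertex or moves to an adjacent vertex. Robert is captured, and the cops win, if he ends his turn on a vertex occupied by a cop or if on his turn he traverses an edge that a cop traversed on her move in the same round (a cop moving onto Robert's vertex does not by itself capture him). The cheating robot number $c_{cr}(G)$ is the least $m$ for which $m$ cops have a strategy that captures Robert after finitely many rounds no matter how he plays. Let $P_n$ denote the path on $n$ vertices. The strong product $\boxtimes_{i=1}^k G_i$ is the graph on $V(G_1)\times\dots\times V(G_k)$ in which two distinct vertices $x,y$ are adjacent if and only if, for every $i$, either $x_i=y_i$ or $x_iy_i\in E(G_i)$. **Theorem.** If $k$ is a positive integer and $n_1,\dots,n_k$ are integers with $n_i\ge 3$ for $1\le i\le k$, then $$c_{cr}\left(\boxtimes_{i=1}^k P_{n_i}\right)\le\sum_{j=0}^{k-1}3^j=\frac{3^k-1}{2}.$$ -/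

import Mathlib

namespace CheatingRobot

/-- The strong product of a family of graphs: two distinct tuples are adjacent iff in every
coordinate their entries are equal or adjacent. -/
def strongProd {ι : Type*} {V : ι → Type*} (G : ∀ i, SimpleGraph (V i)) :
    SimpleGraph (∀ i, V i) where
  Adj x y := x ≠ y ∧ ∀ i, x i = y i ∨ (G i).Adj (x i) (y i)
  symm := ⟨fun _ _ h => ⟨h.1.symm, fun i => (h.2 i).imp Eq.symm fun e => e.symm⟩⟩
  loopless := ⟨fun _ h => h.1 rfl⟩

/-- One legal move of a player: stay, or go to an adjacent vertex. -/
def Step {V : Type*} (G : SimpleGraph V) (u v : V) : Prop := u = v ∨ G.Adj u v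

/-- A (deterministic) strategy for `m` cops. The list records the vertices that Robert has
occupied so far, most recent first: `pos [] i` is the starting vertex of cop `i`, and
`pos [r_t, …, r_0] i` is the vertex of cop `i` after the cops' `(t+1)`-st move, which is made
when Robert has been on `r_0, …, r_t`. Several cops may share a vertex. -/
structure CopStrategy {V : Type*} (G : SimpleGraph V) (m : ℕ) where
  pos : List V → Fin m → V
  legal : ∀ (h : List V) (r : V) (i : Fin m), Step G (pos h i) (pos (r :: h) i)

/-- `history r t` is the list `[r (t-1), …, r 0]`. -/
def history {V : Type*} (r : ℕ → V) : ℕ → List V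
  | 0 => []
  | t + 1 => r t :: history r t

/-- The vertex of cop `i` after `t` cop moves, when Robert follows `r`. -/
def CopStrategy.copAt {V : Type*} {G : SimpleGraph V} {m : ℕ} (S : CopStrategy G m)
    (r : ℕ → V) (t : ℕ) (i : Fin m) : V := S.pos (history r t) i

/-- A legal way for Robert to play against `S`: he starts on a vertex not occupied by a cop, and
each turn he stays or moves to an adjacent vertex. -/
def CopStrategy.RobertPlay {V : Type*} {G : SimpleGraph V} {m : ℕ} (S : CopStrategy G m)
    (r : ℕ → V) : Prop :=
  (∀ i, r 0 ≠ S.copAt r 0 i) ∧ ∀ t, Step G (r t) (r (t + 1))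

/-- In round `t` each cop `i` moves from `copAt r t i` to `copAt r (t+1) i`, and then Robert moves
from `r t` to `r (t+1)`. He is captured in that round if he ends his turn on a vertex occupied by
a cop, or if he traverses the edge that a cop has just traversed (if he does so in the direction
of the cop, he ends on her vertex, so only the opposite direction is listed). A cop moving onto
Robert's vertex does not by itself end the game. -/
def CopStrategy.CapturedAt {V : Type*} {G : SimpleGraph V} {m : ℕ} (S : CopStrategy G m)
    (r : ℕ → V) (t : ℕ) : Prop :=
  ∃ i, S.copAt r (t + 1) i = r (t + 1) ∨
    (S.copAt r t i = r (t + 1) ∧ S.copAt r (t + 1) i = r t)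

/-- The strategy captures Robert after finitely many rounds, however he plays. -/
def CopStrategy.Winning {V : Type*} {G : SimpleGraph V} {m : ℕ} (S : CopStrategy G m) : Prop :=
  ∀ r : ℕ → V, S.RobertPlay r → ∃ t, S.CapturedAt r t

/-- `m` cops can win Cops and Cheating Robot on `G`. -/
def CopsWin {V : Type*} (G : SimpleGraph V) (m : ℕ) : Prop :=
  ∃ S : CopStrategy G m, S.Winning

/-- The cheating robot number: the least number of cops that can win on `G` (`⊤` if no finite
number of cops can, which never happens on a finite graph). -/
noncomputable def cheatingRobotNumber {V : Type*} (G : SimpleGraph V) : ℕ∞ :=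
  ⨅ (m : ℕ) (_ : CopsWin G m), (m : ℕ∞)

end CheatingRobot

namespace CheatingRobot

/-! Read each of Robert's moves as balanced ternary digits; by `ternary_injective` its value
determines it. One cop shadows Robert, and every other cop sits, whenever that vertex exists, where
a move of one fixed value in `-m, …, -2` would take him. Once all are in place
(`chaseStrategy_copAt`), these moves lose, as does standing still. Value `-1` has no guard: that cop
is the shadow, who always traverses Robert's previous edge and so forbids turning straight back. But
moves of nonzero value at least `-1` eventually force such a turn (`exists_return_of_ternary`). -/

/-- Move from `c` one step towards `τ` on the integer line. -/
def approach (c τ : ℤ) : ℤ := max (c - 1) (min (c + 1) τ)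

/-- A pursuer starting at the left end of a segment catches up with any slowly moving target and
then stays on it. -/
theorem approach_eq_target {N : ℕ} {c τ : ℕ → ℤ} (h0 : c 0 = 0)
    (hc : ∀ t, c (t + 1) = approach (c t) (τ t)) (hτ0 : ∀ t, 0 ≤ τ t) (hτN : ∀ t, τ t ≤ N)
    (hτ : ∀ t, |τ (t + 1) - τ t| ≤ 1) {t : ℕ} (ht : N ≤ t) : c (t + 1) = τ t := by
  -- Until she meets the target, the pursuer steps right every time, so she is at `t + 1`; for `t ≥
  -- N` that is past the end.
  have key : ∀ t : ℕ, c (t + 1) = τ t ∨ (c (t + 1) = t + 1 ∧ c (t + 1) < τ t) := by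
    intro t
    induction t with
    | zero =>
      have h1 := hc 0
      have h2 := hτ0 0
      simp only [approach, h0, zero_add] at h1 ⊢
      push_cast
      omega
    | succ t ih =>
      have h1 := hc (t + 1)
      have h2 := abs_le.1 (hτ t)
      simp only [approach] at h1
      push_cast
      omega
  have h1 := hτN t
  rcases key t with h | h
  · exact h
  · omega

/-! ### Balanced ternary and bounded walks -/

/-- The value of a balanced ternary expansion, least significant digit first. -/
def ternary {k : ℕ} (d : Fin k → ℤ) : ℤ := ∑ i, d i * 3 ^ (i : ℕ)

theorem ternary_succ {k : ℕ} (d : Fin (k + 1) → ℤ) :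
    ternary d = d 0 + 3 * ternary (fun i : Fin k => d i.succ) := by
  simp only [ternary, Fin.sum_univ_succ, Finset.mul_sum]
  simp only [Fin.val_zero, pow_zero, mul_one, Fin.val_succ, pow_succ]
  congr 1
  exact Finset.sum_congr rfl fun i _ => by ring

theorem ternary_sub {k : ℕ} (d e : Fin k → ℤ) : ternary (d - e) = ternary d - ternary e := by
  simp [ternary, sub_mul]

theorem ternary_injective {k : ℕ} {d e : Fin k → ℤ} (hd : ∀ i, |d i| ≤ 1) (he : ∀ i, |e i| ≤ 1)
    (h : ternary d = ternary e) : d = e := by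
  induction k with
  | zero => exact Subsingleton.elim _ _
  | succ k ih =>
    rw [ternary_succ, ternary_succ] at h
    have h1 := abs_le.1 (hd 0)
    have h2 := abs_le.1 (he 0)
    have h3 := ih (d := fun i => d i.succ) (e := fun i => e i.succ) (fun i => hd i.succ)
      (fun i => he i.succ) (by omega)
    funext i
    refine Fin.cases ?_ (fun i => congrFun h3 i) i
    omega

theorem ternary_le {k : ℕ} {d : Fin k → ℤ} (hd : ∀ i, |d i| ≤ 1) :
    ternary d ≤ ((∑ j ∈ Finset.range k, 3 ^ j : ℕ) : ℤ) := by
  rw [Finset.sum_range, ternary]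
  push_cast
  refine Finset.sum_le_sum fun i _ => ?_
  have h := (abs_le.1 (hd i)).2
  have h3 : (0 : ℤ) < 3 ^ (i : ℕ) := by positivity
  nlinarith

theorem eventually_const_of_le_succ {b : ℕ → ℤ} {M : ℕ} {B : ℤ}
    (hb : ∀ t, M ≤ t → b t ≤ b (t + 1)) (hB : ∀ t, b t ≤ B) :
    ∃ T, M ≤ T ∧ ∀ t, T ≤ t → b (t + 1) = b t := by
  obtain ⟨z, ⟨T, hT, rfl⟩, hmax⟩ := Int.exists_greatest_of_bdd
    (P := fun z => ∃ t, M ≤ t ∧ b t = z) ⟨B, by rintro z ⟨t, -, rfl⟩; exact hB t⟩ ⟨_, M, le_rfl, rfl⟩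
  have hge : ∀ t, T ≤ t → b T ≤ b t := by
    intro t ht
    induction t, ht using Nat.le_induction with
    | base => exact le_rfl
    | succ t ht ih => exact ih.trans (hb t (hT.trans ht))
  refine ⟨T, hT, fun t ht => ?_⟩
  have h1 := hge t ht
  have h2 := hb t (hT.trans ht)
  have h3 := hmax _ ⟨t + 1, by omega, rfl⟩
  omega

/-- A bounded integer walk with unit steps cannot avoid reversing forever. -/
theorem exists_reversal {a : ℕ → ℤ} {T : ℕ} {N : ℤ} (h0 : ∀ t, 0 ≤ a t) (hN : ∀ t, a t ≤ N)
    (hstep : ∀ t, T ≤ t → |a (t + 1) - a t| = 1) :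
    ∃ t, T ≤ t ∧ a (t + 2) - a (t + 1) = a t - a (t + 1) := by
  by_contra! hrev
  have hconst : ∀ s : ℕ, a (T + s + 1) - a (T + s) = a (T + 1) - a T := by
    intro s
    induction s with
    | zero => rfl
    | succ s ih =>
      have h1 := hstep (T + s) (by omega)
      have h2 := hstep (T + s + 1) (by omega)
      have h3 := hrev (T + s) (by omega)
      rw [← ih]
      simp only [← Nat.add_assoc]
      rw [show T + s + 1 + 1 = T + s + 2 by ring] at h2 ⊢
      rw [abs_eq (by norm_num)] at h1 h2
      omega
  have hlin : ∀ s : ℕ, a (T + s) = a T + s * (a (T + 1) - a T) := by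
    intro s
    induction s with
    | zero => simp
    | succ s ih =>
      have := hconst s
      push_cast
      rw [← Nat.add_assoc]
      linarith
  have h1 := hstep T le_rfl
  have hN0 := (h0 T).trans (hN T)
  -- `N + 1` unit steps in one direction leave `[0, N]`.
  have h2 := hlin (N + 1).toNat
  have h3 := h0 T
  have h4 := hN T
  have h5 := h0 (T + (N + 1).toNat)
  have h6 := hN (T + (N + 1).toNat)
  rw [Int.toNat_of_nonneg (by omega)] at h2
  rw [abs_eq (by norm_num)] at h1
  rcases h1 with h | h <;> rw [h] at h2 <;> omega

/-! ### Coordinates and pursuit in the grid -/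

variable {k : ℕ} {n : Fin k → ℕ}

/-- The strong product of the paths on `n i` vertices. -/
abbrev grid (n : Fin k → ℕ) : SimpleGraph (∀ i, Fin (n i)) :=
  strongProd fun i => SimpleGraph.pathGraph (n i)

/-- The integer coordinates of a vertex of the grid. -/
def coord (v : ∀ i, Fin (n i)) (i : Fin k) : ℤ := ((v i : ℕ) : ℤ)

theorem coord_nonneg (v : ∀ i, Fin (n i)) (i : Fin k) : 0 ≤ coord v i := Int.natCast_nonneg _

theorem coord_lt (v : ∀ i, Fin (n i)) (i : Fin k) : coord v i < n i :=
  Int.ofNat_lt.2 (v i).isLt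

theorem coord_injective {u v : ∀ i, Fin (n i)} (h : coord u = coord v) : u = v := by
  funext i
  exact Fin.ext (Int.ofNat_inj.1 (congrFun h i))

theorem step_grid_iff {u v : ∀ i, Fin (n i)} :
    Step (grid n) u v ↔ ∀ i, |coord v i - coord u i| ≤ 1 := by
  have aux : ∀ i, (u i = v i ∨ (SimpleGraph.pathGraph (n i)).Adj (u i) (v i)) ↔
      |coord v i - coord u i| ≤ 1 := by
    intro i
    rw [SimpleGraph.pathGraph_adj, Fin.ext_iff, abs_le]
    simp only [coord]
    omega
  simp only [← aux]
  constructor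
  · rintro (rfl | h)
    · exact fun i => Or.inl rfl
    · exact h.2
  · intro h
    by_cases huv : u = v
    · exact Or.inl huv
    · exact Or.inr ⟨huv, h⟩

/-- The point of `{0, …, N - 1}` nearest to `z`. -/
def clamp (N : ℕ) (z : ℤ) : ℤ := max 0 (min (N - 1) z)

/-- The vertex reached from `c` by moving one step, in every coordinate, towards the point of the
grid nearest to `τ`. -/
def chase (c : ∀ i, Fin (n i)) (τ : Fin k → ℤ) (i : Fin k) : Fin (n i) :=
  ⟨(approach (coord c i) (clamp (n i) (τ i))).toNat, by
    have h1 := coord_nonneg c i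
    have h2 := coord_lt c i
    simp only [approach, clamp]
    omega⟩

theorem coord_chase (c : ∀ i, Fin (n i)) (τ : Fin k → ℤ) (i : Fin k) :
    coord (chase c τ) i = approach (coord c i) (clamp (n i) (τ i)) := by
  have h1 := coord_nonneg c i
  have h2 := coord_lt c i
  rw [coord, chase]
  refine Int.toNat_of_nonneg ?_
  simp only [approach, clamp]
  omega

theorem step_chase (c : ∀ i, Fin (n i)) (τ : Fin k → ℤ) : Step (grid n) c (chase c τ) := by
  refine step_grid_iff.2 fun i => ?_
  rw [coord_chase, abs_le, approach]
  omega

/-- The cops start at the origin, and cop `j` chases the point at displacement `-off j` from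
Robert. -/
def chaseStrategy (hn : ∀ i, 0 < n i) {m : ℕ} (off : Fin m → Fin k → ℤ) :
    CopStrategy (grid n) m where
  pos h j := h.foldr (fun r c => chase c (coord r - off j)) fun i => ⟨0, hn i⟩
  legal _ _ _ := step_chase _ _

/-- Clamping never increases distances, so the clamped target still moves at most one unit per
round. -/
theorem chaseStrategy_coord (hn : ∀ i, 0 < n i) {m : ℕ} (off : Fin m → Fin k → ℤ)
    {r : ℕ → ∀ i, Fin (n i)} (hr : ∀ t, Step (grid n) (r t) (r (t + 1))) (j : Fin m) (i : Fin k)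
    {t : ℕ} (ht : n i ≤ t) :
    coord ((chaseStrategy hn off).copAt r (t + 1) j) i =
      clamp (n i) (coord (r t) i - off j i) := by
  refine approach_eq_target (c := fun t => coord ((chaseStrategy hn off).copAt r t j) i)
    (τ := fun t => clamp (n i) (coord (r t) i - off j i)) rfl (fun t => coord_chase _ _ _)
    (fun t => ?_) (fun t => ?_) (fun t => ?_) ht
  · simp only [clamp]; omega
  · have := hn i
    simp only [clamp]; omega
  · have h := abs_le.1 (step_grid_iff.1 (hr t) i)
    have := hn i
    rw [abs_le]
    simp only [clamp]; omega

theorem chaseStrategy_copAt (hn : ∀ i, 0 < n i) {m : ℕ} (off : Fin m → Fin k → ℤ)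
    {r : ℕ → ∀ i, Fin (n i)} (hr : ∀ t, Step (grid n) (r t) (r (t + 1))) {j : Fin m}
    {t : ℕ} (ht : ∀ i, n i ≤ t) {v : ∀ i, Fin (n i)} (hv : coord (r t) - off j = coord v) :
    (chaseStrategy hn off).copAt r (t + 1) j = v := by
  refine coord_injective (funext fun i => ?_)
  rw [chaseStrategy_coord hn off hr j i (ht i)]
  have h1 := congrFun hv i
  rw [Pi.sub_apply] at h1
  rw [h1]
  have h2 := coord_nonneg v i
  have h3 := coord_lt v i
  simp only [clamp]
  omega

open Classical in
/-- Cop `0` chases Robert himself; every other cop `j` uses as offset the balanced ternary digits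
of `j + 1`. -/
noncomputable def ternaryOffset (k m : ℕ) (j : Fin m) : Fin k → ℤ :=
  if h : (j : ℕ) ≠ 0 ∧ ∃ d : Fin k → ℤ, (∀ i, |d i| ≤ 1) ∧ ternary d = (j : ℕ) + 1 then
    h.2.choose
  else 0

theorem ternaryOffset_eq {m : ℕ} {j : Fin m} {d : Fin k → ℤ} (hj : (j : ℕ) ≠ 0)
    (hd : ∀ i, |d i| ≤ 1) (hdj : ternary d = (j : ℕ) + 1) : ternaryOffset k m j = d := by
  have h : (j : ℕ) ≠ 0 ∧ ∃ d : Fin k → ℤ, (∀ i, |d i| ≤ 1) ∧ ternary d = (j : ℕ) + 1 :=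
    ⟨hj, d, hd, hdj⟩
  rw [ternaryOffset, dif_pos h]
  exact ternary_injective h.2.choose_spec.1 hd (h.2.choose_spec.2.trans hdj.symm)

theorem ternaryOffset_zero {m : ℕ} {j : Fin m} (hj : (j : ℕ) = 0) : ternaryOffset k m j = 0 := by
  rw [ternaryOffset, dif_neg fun h => h.1 hj]

/-- The digits above the lowest form a bounded quantity `high` that never decreases. Once it is
constant, every move is a unit step in coordinate `0` alone, which must reverse. -/
theorem exists_return_of_ternary {k : ℕ} {n : Fin (k + 1) → ℕ} {r : ℕ → ∀ i, Fin (n i)} {M : ℕ}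
    (hr : ∀ t, Step (grid n) (r t) (r (t + 1)))
    (hge : ∀ t, M ≤ t → -1 ≤ ternary (coord (r (t + 1)) - coord (r t)))
    (hne : ∀ t, M ≤ t → r (t + 1) ≠ r t) : ∃ t, M ≤ t ∧ r (t + 2) = r t := by
  set high : (∀ i, Fin (n i)) → ℤ := fun v => ternary fun i => coord v i.succ
  have hsplit : ∀ v, ternary (coord v) = coord v 0 + 3 * high v := fun v => ternary_succ _
  have hdiff : ∀ s t, ternary (coord (r s) - coord (r t)) =
      coord (r s) 0 - coord (r t) 0 + 3 * (high (r s) - high (r t)) := by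
    intro s t
    rw [ternary_sub, hsplit, hsplit]
    ring
  have hstep := fun t => step_grid_iff.1 (hr t)
  have : Nonempty (∀ i, Fin (n i)) := ⟨r 0⟩
  obtain ⟨v, hv⟩ := Finite.exists_max high
  obtain ⟨T, hMT, hT⟩ := eventually_const_of_le_succ (b := fun t => high (r t)) (M := M)
    (fun t ht => by
      have h1 := hge t ht
      have h2 := abs_le.1 (hstep t 0)
      rw [hdiff] at h1
      -- Three times the change of `high` is at least `-1 - 1 = -2`, so the change is nonnegative.
      omega) fun t => hv (r t)
  have hT' : ∀ t, T ≤ t → ternary (coord (r (t + 1)) - coord (r t)) =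
      coord (r (t + 1)) 0 - coord (r t) 0 := by
    intro t ht
    rw [hdiff, hT t ht]
    ring
  obtain ⟨t, ht, hrev⟩ := exists_reversal (a := fun t => coord (r t) 0) (T := T)
    (fun t => coord_nonneg _ _) (fun t => (coord_lt (r t) 0).le) fun t ht => by
      have h1 := hstep t 0
      have h2 : coord (r (t + 1)) 0 - coord (r t) 0 ≠ 0 := by
        intro h
        refine hne t (hMT.trans ht) (coord_injective (sub_eq_zero.1 ?_))
        refine ternary_injective (fun i => hstep t i) (fun i => by simp) ?_
        rw [hT' t ht, h]
        simp [ternary]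
      exact le_antisymm h1 (Int.one_le_abs h2)
  refine ⟨t, hMT.trans ht, coord_injective ((sub_left_inj (a := coord (r (t + 1)))).1 ?_)⟩
  refine ternary_injective (fun i => hstep (t + 1) i) (fun i => ?_) ?_
  · rw [Pi.sub_apply, abs_sub_comm]
    exact hstep t i
  · have h1 := hT' (t + 1) (by omega)
    have h2 := hT' t ht
    rw [ternary_sub] at h1 h2 ⊢
    rw [ternary_sub]
    rw [show t + 1 + 1 = t + 2 by ring] at h1
    linarith

theorem copsWin_grid (hk : 1 ≤ k) (hn : ∀ i, 0 < n i) :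
    CopsWin (grid n) (∑ j ∈ Finset.range k, 3 ^ j) := by
  obtain ⟨k, rfl⟩ := Nat.exists_eq_add_of_le' hk
  set m := ∑ j ∈ Finset.range (k + 1), 3 ^ j with hm
  have hm0 : 0 < m := Finset.sum_pos (fun _ _ => by positivity) ⟨0, by simp⟩
  refine ⟨chaseStrategy hn (ternaryOffset (k + 1) m), fun r hr => ?_⟩
  by_contra! hcap
  have hsteps := hr.2
  have hM : ∀ t, ∑ i, n i ≤ t → ∀ i, n i ≤ t := fun t ht i =>
    (Finset.single_le_sum (fun _ _ => Nat.zero_le _) (Finset.mem_univ i)).trans ht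
  have hcop0 : ∀ t, ∑ i, n i ≤ t →
      (chaseStrategy hn (ternaryOffset (k + 1) m)).copAt r (t + 1) ⟨0, hm0⟩ = r t := fun t ht =>
    chaseStrategy_copAt hn _ hsteps (hM t ht) (by rw [ternaryOffset_zero rfl, sub_zero])
  obtain ⟨t, ht, hret⟩ := exists_return_of_ternary (M := ∑ i, n i) hsteps
    (fun t ht => by
      by_contra! hlt
      have hd : ∀ i, |(coord (r t) - coord (r (t + 1))) i| ≤ 1 := fun i => by
        rw [Pi.sub_apply, abs_sub_comm]
        exact step_grid_iff.1 (hsteps t) i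
      have hle := ternary_le hd
      rw [← hm] at hle
      rw [ternary_sub] at hlt hle
      -- The reversed move has value between `2` and `m`; subtracting one gives the index of a cop
      -- other than the shadow.
      obtain ⟨j, hj⟩ := Int.eq_ofNat_of_zero_le
        (a := ternary (coord (r t)) - ternary (coord (r (t + 1))) - 1) (by omega)
      refine hcap t ⟨⟨j, by omega⟩, Or.inl ?_⟩
      refine chaseStrategy_copAt hn _ hsteps (hM t ht) ?_
      rw [ternaryOffset_eq (by simp only; omega) hd (by rw [ternary_sub]; simp only; omega)]
      exact sub_sub_cancel _ _)
    (fun t ht heq => hcap t ⟨⟨0, hm0⟩, Or.inl ((hcop0 t ht).trans heq.symm)⟩)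
  exact hcap (t + 1) ⟨⟨0, hm0⟩, Or.inr
    ⟨(hcop0 t ht).trans hret.symm, hcop0 (t + 1) (by omega)⟩⟩

end CheatingRobot

theorem mainTheorem8 (k : ℕ) (hk : 1 ≤ k) (n : Fin k → ℕ) (hn : ∀ i, 3 ≤ n i) :
    CheatingRobot.cheatingRobotNumber
        (CheatingRobot.strongProd fun i => SimpleGraph.pathGraph (n i)) ≤
      ((∑ j ∈ Finset.range k, 3 ^ j : ℕ) : ℕ∞) ∧
    ((∑ j ∈ Finset.range k, 3 ^ j : ℕ) : ℚ) = ((3 : ℚ) ^ k - 1) / 2 := by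
  constructor
  · exact iInf₂_le _ (CheatingRobot.copsWin_grid hk fun i => by have := hn i; omega)
  · push_cast
    rw [geom_sum_eq (by norm_num)]
    norm_num
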